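/- **Theorem (Lieb uncertainty principle for the continuous quaternion Stockwell transform).** Let $\mathbb H$ be the real quaternions with units $i,j,k$ and modulus $|\cdot|$. Equip $\mathbb R^2$ with $d\mu_2(x)=\frac{dx}{2\pi}$ and $\mathbb R^4=\mathbb R^2\times\mathbb R^2$ with $d\mu_4=\frac{d\xi\,db}{(2\pi)^2}$, and let $\|\cdot\|_2$ be the corresponding $L^2$-norms. For $g\in L^1(\mathbb R^2,\mathbb H)$ put $$\mathcal F_Q(g)(u,v)=\int_{\mathbb R^2}e^{-ixu}\,g(x,y)\,e^{-jyv}\,d\mu_2(x,y).$$ For $\xi=(\xi_1,\xi_2)\in\mathbb R^2$ let $A_\xi=\mathrm{diag}(\xi_1,\xi_2)$, so that $\det A_\xi=\xi_1\xi_2$. Let $\varphi\in L^1(\mathbb R^2,\mathbb H)\cap L^2(\mathbb R^2,\mathbb H)$ be a nonzero admissible window, i.e. $$0<C_\varphi:=\int_{\mathbb R^2}\big|\mathcal F_Q(\overline\varphi)(1-\xi_1,1-\xi_2)\big|^2\,\frac{d\mu_2(\xi)}{|\det A_\xi|}<\infty ,$$ and assume that for all $u,v,y\in\mathbb R$ $$\mathcal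 F_Q(\varphi)(u,v)\,e^{-jvy}=e^{-jvy}\,\mathcal F_Q(\varphi)(u,v),\qquad \mathcal F_Q(j\varphi)(u,v)\,e^{-jvy}=j\,e^{-jvy}\,\mathcal F_Q(\varphi)(u,v).$$ For $f\in L^2(\mathbb R^2,\mathbb H)$ let $$(S^Q_\varphi f)(\xi,b)=|\det A_\xi|^{1/2}\int_{\mathbb R^2}e^{-ix_1\xi_1}f(x)\,e^{-jx_2\xi_2}\,\overline{\varphi(A_\xi(x-b))}\,d\mu_2(x),\qquad \xi,b\in\mathbb R^2 .$$ Let $f\in L^2(\mathbb R^2,\mathbb H)$ with $f\neq0$, let $\Sigma\subset\mathbb R^2\times\mathbb R^2$ be measurable and let $0\le\alpha\le1$. If $S^Q_\varphi f$ is $\alpha$-concentrated on $\Sigma$, that is, $$\Big(\int_{\Sigma^c}|S^Q_\varphi f|^2\,d\mu_4\Big)^{1/2}\le\alpha\,\|S^Q_\varphi f\|_2 ,$$ then for every real $p>2$ $$\mu_4(\Sigma)\ \ge\ \frac{C_\varphi\,(1-\alpha^2)^{\frac p{p-2}}}{\|\varphi\|_2^2}.$$ -/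

import Mathlib

open MeasureTheory
open scoped ENNReal Quaternion

namespace QStockwell

noncomputable section

/-- The normalized Lebesgue measure `dx / (2π)` on `ℝ²`. -/
def mu2 : Measure (ℝ × ℝ) := ENNReal.ofReal (1 / (2 * Real.pi)) • volume

/-- The normalized Lebesgue measure `dx / (2π)²` on `ℝ⁴ = ℝ² × ℝ²`. -/
def mu4 : Measure ((ℝ × ℝ) × (ℝ × ℝ)) := ENNReal.ofReal (1 / (2 * Real.pi) ^ 2) • volume

/-- The quaternion unit `i`. -/
def qi : ℍ[ℝ] := ⟨0, 1, 0, 0⟩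

/-- The quaternion unit `j`. -/
def qj : ℍ[ℝ] := ⟨0, 0, 1, 0⟩

/-- `exp (i t)`. -/
def expI (t : ℝ) : ℍ[ℝ] := NormedSpace.exp (t • qi)

/-- `exp (j t)`. -/
def expJ (t : ℝ) : ℍ[ℝ] := NormedSpace.exp (t • qj)

/-- The two-sided quaternion Fourier transform
`F_Q(f)(u,v) = ∫ exp(-i x u) f(x,y) exp(-j y v) dμ₂(x,y)` (for integrable `f`). -/
def qft (f : ℝ × ℝ → ℍ[ℝ]) (w : ℝ × ℝ) : ℍ[ℝ] :=
  ∫ x, expI (-(x.1 * w.1)) * f x * expJ (-(x.2 * w.2)) ∂mu2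

/-- The hypothesis on `g` in the convolution theorem for the quaternion Fourier transform:
`F_Q(g)(u,v) exp(-j v y) = exp(-j v y) F_Q(g)(u,v)` and
`F_Q(j g)(u,v) exp(-j v y) = j exp(-j v y) F_Q(g)(u,v)`. -/
def ConvolutionCondition (g : ℝ × ℝ → ℍ[ℝ]) : Prop :=
  ∀ u v y : ℝ,
    qft g (u, v) * expJ (-(v * y)) = expJ (-(v * y)) * qft g (u, v) ∧
    qft (fun x => qj * g x) (u, v) * expJ (-(v * y)) = qj * expJ (-(v * y)) * qft g (u, v)

/-- `det A_ξ`, where `A_ξ` is the diagonal matrix with entries `ξ₁, ξ₂`. -/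
def detA (ξ : ℝ × ℝ) : ℝ := ξ.1 * ξ.2

/-- `A_ξ x`, where `A_ξ` is the diagonal matrix with entries `ξ₁, ξ₂`. -/
def mulA (ξ x : ℝ × ℝ) : ℝ × ℝ := (ξ.1 * x.1, ξ.2 * x.2)

/-- The admissibility constant
`C_φ = ∫ |F_Q(conj φ)(1 - ξ)|² / |det A_ξ| dμ₂(ξ)` in `[0, ∞]`, where `1 = (1, 1)`. -/
def admConst (φ : ℝ × ℝ → ℍ[ℝ]) : ℝ≥0∞ :=
  ∫⁻ ξ, ENNReal.ofReal
    (‖qft (fun x => star (φ x)) (1 - ξ.1, 1 - ξ.2)‖ ^ 2 / |detA ξ|) ∂mu2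

/-- Admissible quaternion windows: nonzero `φ` in `L¹ ∩ L²` with `0 < C_φ < ∞`. -/
structure IsAdmissibleWindow (φ : ℝ × ℝ → ℍ[ℝ]) : Prop where
  memL1 : MemLp φ 1 mu2
  memL2 : MemLp φ 2 mu2
  ne_zero : ¬ (φ =ᵐ[mu2] 0)
  const_pos : 0 < admConst φ
  const_lt_top : admConst φ < ∞

/-- The two-dimensional continuous quaternion Stockwell transform
`(S_φ f)(ξ,b) = |det A_ξ|^{1/2} ∫ exp(-i x₁ ξ₁) f(x) exp(-j x₂ ξ₂) conj(φ(A_ξ(x-b))) dμ₂(x)`. -/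
def stockwell (φ f : ℝ × ℝ → ℍ[ℝ]) (z : (ℝ × ℝ) × (ℝ × ℝ)) : ℍ[ℝ] :=
  Real.sqrt |detA z.1| •
    ∫ x, expI (-(x.1 * z.1.1)) * f x * expJ (-(x.2 * z.1.2)) * star (φ (mulA z.1 (x - z.2))) ∂mu2

/-- `F` is `α`-concentrated on `S`:
`(∫_{Sᶜ} |F|² dμ₄)^{1/2} ≤ α (∫ |F|² dμ₄)^{1/2}`. -/
def IsConcentrated (α : ℝ) (F : (ℝ × ℝ) × (ℝ × ℝ) → ℍ[ℝ]) (S : Set ((ℝ × ℝ) × (ℝ × ℝ))) : Prop :=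
  eLpNorm F 2 (mu4.restrict Sᶜ) ≤ ENNReal.ofReal α * eLpNorm F 2 mu4

end

end QStockwell

/-! Two facts carry the bound. Plancherel (`lintegral_stockwell_sq`) gives the transform energy
C_φ‖f‖², and Cauchy–Schwarz (`enorm_stockwell_le`) bounds it pointwise by ‖f‖‖φ‖. Concentration
leaves at least (1-α²)C_φ‖f‖² on Σ, while the pointwise bound allows at most μ₄(Σ)‖f‖²‖φ‖².
Cancelling ‖f‖² yields μ₄(Σ) ≥ C_φ(1-α²)/‖φ‖², which is already stronger than the bound for each p,
since p/(p-2) ≥ 1 and 0 ≤ 1-α² ≤ 1. No Lieb-type L^p inequality is needed.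

The work lies in Plancherel. Left multiplication by i and right multiplication by j commute, so ℍ
splits into two complex lines (`projM`, `projP`) on which both act as scalars. The convolution
condition forces φ to take values in ℝ+ℝj (`projP_ae_eq_projM`) and to be even in its first variable
(`projP_reflect_ae_eq`). Right multiplication by the conjugate of φ is then scalar too, and the
transform decouples into two scalar Stockwell transforms with one common window.

For fixed ξ the scalar transform is a convolution in b. Scalar Plancherel in b, followed by
invariance of dξ/|det A_ξ| under ξ ↦ ω/ξ, produces the constant; density of L¹ ∩ L² then gives
`lintegral_cStock_sq`. -/

namespace QStockwell

/-! ### Plancherel on L¹ ∩ L² of a Euclidean space -/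

section Fourier

open FourierTransform

/-- The integral Fourier transform of a function in `L¹ ∩ L²` represents its `L²` Fourier
transform. -/
theorem fourier_toLp_ae_eq {V : Type*} [NormedAddCommGroup V] [InnerProductSpace ℝ V]
    [FiniteDimensional ℝ V] [MeasurableSpace V] [BorelSpace V] {g : V → ℂ}
    (h1 : MemLp g 1) (h2 : MemLp g 2) :
    (𝓕 (h2.toLp g) : Lp (α := V) ℂ 2 volume) =ᵐ[volume] (𝓕 g : V → ℂ) := by
  have hcont : Continuous (𝓕 g : V → ℂ) :=
    VectorFourier.fourierIntegral_continuous Real.continuous_fourierChar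
      (innerSL ℝ).continuous₂ (memLp_one_iff_integrable.1 h1)
  have hG : LocallyIntegrable (fun x => (𝓕 (h2.toLp g) : Lp (α := V) ℂ 2 volume) x) volume :=
    (Lp.memLp _).locallyIntegrable one_le_two
  -- Both transforms define the same distribution: `e1` is the duality defining the tempered Fourier
  -- transform, `e2` moves the integral transform across by Fubini.
  have key := ae_eq_zero_of_integral_contDiff_smul_eq_zero
    (hG.sub hcont.locallyIntegrable) (fun s hs hc => by
      have hc' : HasCompactSupport (Complex.ofRealCLM ∘ s) := hc.comp_left rfl
      have hs' : ContDiff ℝ (⊤ : ℕ∞) (Complex.ofRealCLM ∘ s) :=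
        Complex.ofRealCLM.contDiff.comp hs
      set σ := hc'.toSchwartzMap hs' with hσ
      have e1 : ∫ x, σ x • (𝓕 (h2.toLp g) : Lp (α := V) ℂ 2 volume) x = ∫ x, (𝓕 σ) x • g x := by
        rw [← Lp.toTemperedDistribution_apply, ← Lp.fourier_toTemperedDistribution_eq,
          TemperedDistribution.fourier_apply, Lp.toTemperedDistribution_apply]
        refine integral_congr_ae ?_
        filter_upwards [h2.coeFn_toLp] with x hx
        rw [hx]
      have e2 : ∫ x, (𝓕 σ) x • g x = ∫ x, σ x • (𝓕 g) x := by
        rw [SchwartzMap.fourier_coe]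
        simpa using! VectorFourier.integral_fourierIntegral_smul_eq_flip (L := innerₗ V)
          Real.continuous_fourierChar continuous_inner σ.integrable (memLp_one_iff_integrable.1 h1)
      have i1 : Integrable (fun x => s x • (𝓕 (h2.toLp g) : Lp (α := V) ℂ 2 volume) x) :=
        hG.integrable_smul_left_of_hasCompactSupport hs.continuous hc
      have i2 : Integrable (fun x => s x • (𝓕 g) x) :=
        hcont.locallyIntegrable.integrable_smul_left_of_hasCompactSupport hs.continuous hc
      have e3 := e1.trans e2
      simp only [Pi.sub_apply, smul_sub]
      rw [integral_sub i1 i2, sub_eq_zero]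
      simpa [hσ] using e3)
  filter_upwards [key] with x hx
  exact sub_eq_zero.1 hx

/-- Plancherel's theorem for the integral Fourier transform on `L¹ ∩ L²`. -/
theorem lintegral_enorm_fourier_sq {V : Type*} [NormedAddCommGroup V] [InnerProductSpace ℝ V]
    [FiniteDimensional ℝ V] [MeasurableSpace V] [BorelSpace V] {g : V → ℂ}
    (h1 : MemLp g 1) (h2 : MemLp g 2) :
    ∫⁻ w, ‖(𝓕 g : V → ℂ) w‖ₑ ^ 2 = ∫⁻ x, ‖g x‖ₑ ^ 2 := by
  have h := Lp.norm_fourier_eq (h2.toLp g)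
  rw [Lp.norm_def, Lp.norm_def, ENNReal.toReal_eq_toReal_iff' (Lp.eLpNorm_ne_top _)
    (Lp.eLpNorm_ne_top _), eLpNorm_congr_ae (fourier_toLp_ae_eq h1 h2),
    eLpNorm_congr_ae h2.coeFn_toLp] at h
  have hsq (F : V → ℂ) : eLpNorm F 2 volume ^ 2 = ∫⁻ x, ‖F x‖ₑ ^ 2 := by
    have := eLpNorm_nnreal_pow_eq_lintegral (f := F) (μ := volume) (p := 2) two_ne_zero
    simpa using this
  rw [← hsq, ← hsq, h]

end Fourier

/-! ### Diagonal dilations and the normalized measure on ℝ² -/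

section Dilation

theorem mu2_eq_smul : mu2 = ENNReal.ofReal (1 / (2 * Real.pi)) • volume := rfl

theorem ofReal_inv_two_pi_ne_zero : ENNReal.ofReal (1 / (2 * Real.pi)) ≠ 0 := by
  rw [ne_eq, ENNReal.ofReal_eq_zero, not_le]; positivity

instance : mu2.IsAddHaarMeasure :=
  Measure.IsAddHaarMeasure.smul _ ofReal_inv_two_pi_ne_zero ENNReal.ofReal_ne_top

theorem ae_mu2_iff {p : ℝ × ℝ → Prop} : (∀ᵐ x ∂mu2, p x) ↔ ∀ᵐ x, p x :=
  Measure.ae_ennreal_smul_measure_iff ofReal_inv_two_pi_ne_zero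

theorem lintegral_mu2 (F : ℝ × ℝ → ℝ≥0∞) :
    ∫⁻ x, F x ∂mu2 = ENNReal.ofReal (1 / (2 * Real.pi)) * ∫⁻ x, F x := by
  rw [mu2_eq_smul, lintegral_smul_measure, smul_eq_mul]

theorem integral_mu2 {E : Type*} [NormedAddCommGroup E] [NormedSpace ℝ E] (F : ℝ × ℝ → E) :
    ∫ x, F x ∂mu2 = (1 / (2 * Real.pi)) • ∫ x, F x := by
  rw [mu2_eq_smul, integral_smul_measure, ENNReal.toReal_ofReal (by positivity)]

theorem mulA_measurableEmbedding {ξ : ℝ × ℝ} (h : detA ξ ≠ 0) : MeasurableEmbedding (mulA ξ) :=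
  (measurableEmbedding_mulLeft₀ (left_ne_zero_of_mul h)).prodMap
    (measurableEmbedding_mulLeft₀ (right_ne_zero_of_mul h))

theorem map_mulA_mu2 {ξ : ℝ × ℝ} (h : detA ξ ≠ 0) :
    mu2.map (mulA ξ) = ENNReal.ofReal |detA ξ|⁻¹ • mu2 := by
  have hv : (volume : Measure (ℝ × ℝ)).map (mulA ξ) = ENNReal.ofReal |detA ξ|⁻¹ • volume := by
    change Measure.map (Prod.map (ξ.1 * ·) (ξ.2 * ·)) (volume.prod volume) = _
    rw [← Measure.map_prod_map _ _ (by fun_prop) (by fun_prop),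
      Real.map_volume_mul_left (left_ne_zero_of_mul h),
      Real.map_volume_mul_left (right_ne_zero_of_mul h), Measure.prod_smul_left,
      Measure.prod_smul_right, smul_smul, ← ENNReal.ofReal_mul (abs_nonneg _), detA, mul_comm,
      ← abs_mul, ← mul_inv, abs_inv, mul_comm]
    rfl
  rw [mu2_eq_smul, Measure.map_smul, hv, smul_comm]

theorem lintegral_comp_mulA {ξ : ℝ × ℝ} (h : detA ξ ≠ 0) (F : ℝ × ℝ → ℝ≥0∞) :
    ∫⁻ x, F (mulA ξ x) ∂mu2 = ENNReal.ofReal |detA ξ|⁻¹ * ∫⁻ x, F x ∂mu2 := by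
  rw [← (mulA_measurableEmbedding h).lintegral_map, map_mulA_mu2 h, lintegral_smul_measure,
    smul_eq_mul]

theorem integral_comp_mulA {E : Type*} [NormedAddCommGroup E] [NormedSpace ℝ E] {ξ : ℝ × ℝ}
    (h : detA ξ ≠ 0) (F : ℝ × ℝ → E) :
    ∫ x, F (mulA ξ x) ∂mu2 = |detA ξ|⁻¹ • ∫ x, F x ∂mu2 := by
  rw [← (mulA_measurableEmbedding h).integral_map, map_mulA_mu2 h, integral_smul_measure,
    ENNReal.toReal_ofReal (by positivity)]

theorem quasiMeasurePreserving_mulA {ξ : ℝ × ℝ} (h : detA ξ ≠ 0) :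
    Measure.QuasiMeasurePreserving (mulA ξ) mu2 mu2 :=
  ⟨(mulA_measurableEmbedding h).measurable, by
    rw [map_mulA_mu2 h]; exact Measure.smul_absolutelyContinuous⟩

theorem memLp_comp_mulA {E : Type*} [NormedAddCommGroup E] {ξ : ℝ × ℝ} (h : detA ξ ≠ 0)
    {F : ℝ × ℝ → E} {p : ℝ≥0∞} (hF : MemLp F p mu2) : MemLp (fun x => F (mulA ξ x)) p mu2 := by
  have : MemLp F p (mu2.map (mulA ξ)) := by
    rw [map_mulA_mu2 h]; exact hF.smul_measure ENNReal.ofReal_ne_top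
  exact this.comp_of_map (mulA_measurableEmbedding h).measurable.aemeasurable

end Dilation

/-! ### Plancherel in the normalization of `mu2` -/

section Plancherel

open FourierTransform

/-- The scalar Fourier transform on `ℝ²` with respect to `mu2`. -/
noncomputable def ft (g : ℝ × ℝ → ℂ) (w : ℝ × ℝ) : ℂ :=
  ∫ x, Complex.exp (-((x.1 * w.1 + x.2 * w.2 : ℝ) * Complex.I)) * g x ∂mu2

/-- `ℝ × ℝ` carries the sup norm, so ℂ serves as the Euclidean plane. The kernel exp(-2πi⟨v,w⟩)
accounts for the frequency dilation, the density of `mu2` for the prefactor. -/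
theorem fourier_comp_equivRealProd (g : ℝ × ℝ → ℂ) (w : ℂ) :
    𝓕 (fun v : ℂ => g (Complex.measurableEquivRealProd v)) w =
      (2 * Real.pi : ℝ) • ft g (mulA (2 * Real.pi, 2 * Real.pi)
        (Complex.measurableEquivRealProd w)) := by
  rw [Real.fourier_eq', ft, integral_mu2, smul_smul, mul_one_div_cancel (by positivity), one_smul,
    ← Complex.volume_preserving_equiv_real_prod.integral_comp
      Complex.measurableEquivRealProd.measurableEmbedding]
  refine integral_congr_ae (ae_of_all _ fun v => ?_)
  simp only [smul_eq_mul, mulA, Complex.measurableEquivRealProd_apply, Complex.inner]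
  congr 2
  simp
  ring

/-- Plancherel's theorem for `ft`. -/
theorem lintegral_enorm_ft_sq {g : ℝ × ℝ → ℂ} (h1 : MemLp g 1 mu2) (h2 : MemLp g 2 mu2) :
    ∫⁻ w, ‖ft g w‖ₑ ^ 2 ∂mu2 = ∫⁻ x, ‖g x‖ₑ ^ 2 ∂mu2 := by
  have hvol {p : ℝ≥0∞} (h : MemLp g p mu2) : MemLp g p volume := by
    have := h.smul_measure (c := (ENNReal.ofReal (1 / (2 * Real.pi)))⁻¹)
      (ENNReal.inv_ne_top.2 ofReal_inv_two_pi_ne_zero)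
    rwa [mu2_eq_smul, smul_smul, ENNReal.inv_mul_cancel ofReal_inv_two_pi_ne_zero
      ENNReal.ofReal_ne_top, one_smul] at this
  have hmp := Complex.volume_preserving_equiv_real_prod
  have hme := Complex.measurableEquivRealProd.measurableEmbedding
  have key := lintegral_enorm_fourier_sq ((hvol h1).comp_measurePreserving hmp)
    ((hvol h2).comp_measurePreserving hmp)
  have hd : detA (2 * Real.pi, 2 * Real.pi) ≠ 0 := by
    simp only [detA]; positivity
  simp only [Function.comp_def, fourier_comp_equivRealProd, enorm_smul] at key
  rw [hmp.lintegral_comp_emb hme (fun w => (‖2 * Real.pi‖ₑ *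
    ‖ft g (mulA (2 * Real.pi, 2 * Real.pi) w)‖ₑ) ^ 2),
    hmp.lintegral_comp_emb hme (fun x => ‖g x‖ₑ ^ 2)] at key
  have h3 := lintegral_comp_mulA hd (fun w => (‖2 * Real.pi‖ₑ * ‖ft g w‖ₑ) ^ 2)
  rw [lintegral_mu2, key, ← lintegral_mu2] at h3
  rw [h3]
  simp only [mul_pow]
  rw [lintegral_const_mul' _ _ (by finiteness), ← mul_assoc]
  have : ENNReal.ofReal |detA (2 * Real.pi, 2 * Real.pi)|⁻¹ * ‖2 * Real.pi‖ₑ ^ 2 = 1 := by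
    rw [Real.enorm_eq_ofReal (by positivity), ← ENNReal.ofReal_pow (by positivity),
      ← ENNReal.ofReal_mul (by positivity), detA, abs_of_pos (by positivity), ← sq,
      inv_mul_cancel₀ (by positivity), ENNReal.ofReal_one]
  rw [this, one_mul]

end Plancherel

/-! ### Cauchy–Schwarz bounds -/

section Holder

theorem eLpNorm_two_sq {X E : Type*} [MeasurableSpace X] [NormedAddCommGroup E] (f : X → E)
    (μ : Measure X) : eLpNorm f 2 μ ^ 2 = ∫⁻ x, ‖f x‖ₑ ^ 2 ∂μ := by
  have := eLpNorm_nnreal_pow_eq_lintegral (f := f) (μ := μ) (p := 2) two_ne_zero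
  simpa using this

theorem lintegral_enorm_mul_enorm_le {X E F : Type*} [MeasurableSpace X] [NormedAddCommGroup E]
    [NormedAddCommGroup F] {μ : Measure X} {f : X → E} {g : X → F}
    (hf : AEStronglyMeasurable f μ) (hg : AEStronglyMeasurable g μ) :
    ∫⁻ x, ‖f x‖ₑ * ‖g x‖ₑ ∂μ ≤ eLpNorm f 2 μ * eLpNorm g 2 μ := by
  have h := ENNReal.lintegral_mul_le_Lp_mul_Lq μ Real.HolderConjugate.two_two hf.enorm hg.enorm
  simpa [eLpNorm_eq_lintegral_rpow_enorm_toReal two_ne_zero ENNReal.ofNat_ne_top] using h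

theorem integrable_mul_of_memLp_two {X E : Type*} [MeasurableSpace X] [NormedRing E] [NormMulClass E]
    {μ : Measure X} {f g : X → E} (hf : MemLp f 2 μ) (hg : MemLp g 2 μ) :
    Integrable (fun x => f x * g x) μ := by
  refine ⟨hf.1.mul hg.1, (lintegral_mono fun x => (enorm_mul _ _).le).trans_lt ?_⟩
  exact (lintegral_enorm_mul_enorm_le hf.1 hg.1).trans_lt (ENNReal.mul_lt_top hf.2 hg.2)

/-- |f|² ≤ M|f|. This makes the scalar transform square integrable in b, so that Plancherel applies
to it. -/
theorem memLp_two_of_integrable_of_bound {X E : Type*} [MeasurableSpace X] [NormedAddCommGroup E]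
    {μ : Measure X} {f : X → E} (hf : Integrable f μ) {M : ℝ≥0∞} (hM : M ≠ ∞)
    (h : ∀ x, ‖f x‖ₑ ≤ M) : MemLp f 2 μ := by
  refine ⟨hf.1, ?_⟩
  have : eLpNorm f 2 μ ^ 2 < ∞ := by
    rw [eLpNorm_two_sq]
    calc ∫⁻ x, ‖f x‖ₑ ^ 2 ∂μ ≤ ∫⁻ x, M * ‖f x‖ₑ ∂μ :=
          lintegral_mono fun x => by rw [sq]; exact mul_le_mul_left (h x) _
      _ = M * ∫⁻ x, ‖f x‖ₑ ∂μ := lintegral_const_mul' _ _ hM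
      _ < ∞ := ENNReal.mul_lt_top hM.lt_top hf.2
  simpa using this

theorem quasiMeasurePreserving_mulA_sub {ξ : ℝ × ℝ} (h : detA ξ ≠ 0) (b : ℝ × ℝ) :
    Measure.QuasiMeasurePreserving (fun x => mulA ξ (x - b)) mu2 mu2 :=
  (quasiMeasurePreserving_mulA h).comp
    (measurePreserving_sub_right mu2 b).quasiMeasurePreserving

theorem memLp_comp_mulA_sub {E : Type*} [NormedAddCommGroup E] {ξ : ℝ × ℝ} (h : detA ξ ≠ 0)
    (b : ℝ × ℝ) {F : ℝ × ℝ → E} {p : ℝ≥0∞} (hF : MemLp F p mu2) :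
    MemLp (fun x => F (mulA ξ (x - b))) p mu2 :=
  (memLp_comp_mulA h hF).comp_measurePreserving (measurePreserving_sub_right mu2 b)

theorem eLpNorm_comp_mulA_sub {E : Type*} [NormedAddCommGroup E] {ξ : ℝ × ℝ} (h : detA ξ ≠ 0)
    (b : ℝ × ℝ) (F : ℝ × ℝ → E) :
    ‖Real.sqrt |detA ξ|‖ₑ * eLpNorm (fun x => F (mulA ξ (x - b))) 2 mu2 = eLpNorm F 2 mu2 := by
  refine (ENNReal.pow_right_strictMono two_ne_zero).injective ?_
  rw [mul_pow, eLpNorm_two_sq, eLpNorm_two_sq,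
    lintegral_sub_right_eq_self (fun x => ‖F (mulA ξ x)‖ₑ ^ 2) b,
    lintegral_comp_mulA h (fun x => ‖F x‖ₑ ^ 2), ← mul_assoc, Real.enorm_eq_ofReal (by positivity),
    ← ENNReal.ofReal_pow (by positivity), Real.sq_sqrt (abs_nonneg _),
    ← ENNReal.ofReal_mul (abs_nonneg _), mul_inv_cancel₀ (abs_ne_zero.2 h), ENNReal.ofReal_one,
    one_mul]

/-- The Cauchy–Schwarz bound for the integrand of the Stockwell transform. -/
theorem sqrt_detA_mul_lintegral_le {E F : Type*} [NormedAddCommGroup E] [NormedAddCommGroup F]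
    {f : ℝ × ℝ → E} {g : ℝ × ℝ → F} (hf : AEStronglyMeasurable f mu2)
    (hg : AEStronglyMeasurable g mu2) (ξ b : ℝ × ℝ) :
    ‖Real.sqrt |detA ξ|‖ₑ * ∫⁻ x, ‖f x‖ₑ * ‖g (mulA ξ (x - b))‖ₑ ∂mu2 ≤
      eLpNorm f 2 mu2 * eLpNorm g 2 mu2 := by
  -- A degenerate dilation need not preserve null sets, but there the prefactor vanishes.
  by_cases h : detA ξ = 0
  · simp [h]
  calc _ ≤ ‖Real.sqrt |detA ξ|‖ₑ *
        (eLpNorm f 2 mu2 * eLpNorm (fun x => g (mulA ξ (x - b))) 2 mu2) := by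
        gcongr
        exact lintegral_enorm_mul_enorm_le hf
          (hg.comp_quasiMeasurePreserving (quasiMeasurePreserving_mulA_sub h b))
    _ = _ := by rw [mul_left_comm, eLpNorm_comp_mulA_sub h]

end Holder

/-! ### Characters and the convolution theorem -/

section Convolution

/-- The character `exp (-i x·w)` of `ℝ²`. -/
noncomputable def chr (w x : ℝ × ℝ) : ℂ :=
  Complex.exp (-((x.1 * w.1 + x.2 * w.2 : ℝ) * Complex.I))

theorem continuous_chr : Continuous fun p : (ℝ × ℝ) × (ℝ × ℝ) => chr p.1 p.2 := by
  unfold chr; fun_prop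

theorem norm_chr (w x : ℝ × ℝ) : ‖chr w x‖ = 1 := by
  rw [chr, ← neg_mul, ← Complex.ofReal_neg, Complex.norm_exp_ofReal_mul_I]

theorem enorm_chr (w x : ℝ × ℝ) : ‖chr w x‖ₑ = 1 := by
  rw [← ofReal_norm, norm_chr, ENNReal.ofReal_one]

theorem chr_add_left (v w x : ℝ × ℝ) : chr (v + w) x = chr v x * chr w x := by
  rw [chr, chr, chr, ← Complex.exp_add]
  congr 1
  simp only [Prod.fst_add, Prod.snd_add]
  push_cast
  ring

theorem chr_add_right (w x y : ℝ × ℝ) : chr w (x + y) = chr w x * chr w y := by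
  rw [chr, chr, chr, ← Complex.exp_add]
  congr 1
  simp only [Prod.fst_add, Prod.snd_add]
  push_cast
  ring

theorem ft_eq (g : ℝ × ℝ → ℂ) (w : ℝ × ℝ) : ft g w = ∫ x, chr w x * g x ∂mu2 := rfl

theorem memLp_chr_mul {h : ℝ × ℝ → ℂ} {p : ℝ≥0∞} (hh : MemLp h p mu2) (ξ : ℝ × ℝ) :
    MemLp (fun x => chr ξ x * h x) p mu2 := by
  refine hh.of_le ?_ (ae_of_all _ fun x => by rw [norm_mul, norm_chr, one_mul])
  exact (continuous_chr.comp (by fun_prop : Continuous fun x : ℝ × ℝ =>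
    (ξ, x))).aestronglyMeasurable.mul hh.1

theorem continuous_ft {g : ℝ × ℝ → ℂ} (hg : Integrable g mu2) : Continuous (ft g) := by
  refine continuous_of_dominated (bound := fun x => ‖g x‖) (fun w => ?_) (fun w => ?_) hg.norm ?_
  · exact (memLp_chr_mul (memLp_one_iff_integrable.2 hg) w).1
  · exact ae_of_all _ fun x => by 
      rw [norm_mul, show ‖Complex.exp _‖ = 1 from norm_chr w x, one_mul]
  · exact ae_of_all _ fun x => by fun_prop

theorem ft_chr_mul (h : ℝ × ℝ → ℂ) (ξ w : ℝ × ℝ) :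
    ft (fun x => chr ξ x * h x) w = ft h (w + ξ) := by
  simp only [ft_eq, ← mul_assoc, chr_add_left]

theorem ft_comp_mulA {ξ : ℝ × ℝ} (h : detA ξ ≠ 0) (ψ : ℝ × ℝ → ℂ) (w : ℝ × ℝ) :
    ft (fun x => ψ (mulA ξ x)) w = |detA ξ|⁻¹ • ft ψ (w.1 / ξ.1, w.2 / ξ.2) := by
  rw [ft_eq, ft_eq, ← integral_comp_mulA h]
  refine integral_congr_ae (ae_of_all _ fun x => ?_)
  have h1 : ξ.1 ≠ 0 := left_ne_zero_of_mul h
  have h2 : ξ.2 ≠ 0 := right_ne_zero_of_mul h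
  simp only [chr, mulA]
  congr 5
  field_simp

/-- A character is multiplicative, so twisting a convolution twists both factors; the integral of a
convolution is the product of the integrals. -/
theorem ft_convolution {H K : ℝ × ℝ → ℂ} (hH : Integrable H mu2) (hK : Integrable K mu2)
    (w : ℝ × ℝ) : ft (convolution H K (.mul ℂ ℂ) mu2) w = ft H w * ft K w := by
  have h1 := memLp_one_iff_integrable.1 (memLp_chr_mul (memLp_one_iff_integrable.2 hH) w)
  have h2 := memLp_one_iff_integrable.1 (memLp_chr_mul (memLp_one_iff_integrable.2 hK) w)
  have := integral_convolution (.mul ℂ ℂ) h1 h2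
  rw [ft_eq, ft_eq, ft_eq]
  refine Eq.trans (integral_congr_ae (ae_of_all _ fun b => ?_)) this
  simp only [convolution, ContinuousLinearMap.mul_apply']
  rw [← integral_const_mul]
  refine integral_congr_ae (ae_of_all _ fun t => ?_)
  have : chr w b = chr w t * chr w (b - t) := by rw [← chr_add_right, add_sub_cancel]
  simp only [this]
  ring

end Convolution

/-! ### The scalar Stockwell transform at fixed frequency -/

section ComplexStockwell

/-- The scalar Stockwell transform with analysing function `ψ`. -/
noncomputable def cStock (ψ h : ℝ × ℝ → ℂ) (z : (ℝ × ℝ) × (ℝ × ℝ)) : ℂ :=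
  Real.sqrt |detA z.1| • ∫ x, chr z.1 x * h x * ψ (mulA z.1 (x - z.2)) ∂mu2

theorem enorm_cStock_le {ψ h : ℝ × ℝ → ℂ} (hψ : AEStronglyMeasurable ψ mu2)
    (hh : AEStronglyMeasurable h mu2) (z : (ℝ × ℝ) × (ℝ × ℝ)) :
    ‖cStock ψ h z‖ₑ ≤ eLpNorm h 2 mu2 * eLpNorm ψ 2 mu2 := by
  refine le_trans ?_ (sqrt_detA_mul_lintegral_le hh hψ z.1 z.2)
  rw [cStock, enorm_smul]
  gcongr
  refine (enorm_integral_le_lintegral_enorm _).trans_eq ?_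
  simp only [enorm_mul, enorm_chr, one_mul]

theorem mulA_neg_left (ξ x : ℝ × ℝ) : mulA (-ξ) x = mulA ξ (-x) := by
  simp [mulA]

theorem detA_neg (ξ : ℝ × ℝ) : detA (-ξ) = detA ξ := by
  simp [detA]

/-- Plancherel's theorem in the translation variable of the scalar Stockwell transform. -/
theorem lintegral_cStock_sq_of_detA_ne_zero {ψ h : ℝ × ℝ → ℂ} (hψ1 : MemLp ψ 1 mu2)
    (hψ2 : MemLp ψ 2 mu2) (hh1 : MemLp h 1 mu2) (hh2 : MemLp h 2 mu2) {ξ : ℝ × ℝ}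
    (hξ : detA ξ ≠ 0) :
    ∫⁻ b, ‖cStock ψ h (ξ, b)‖ₑ ^ 2 ∂mu2 =
      ∫⁻ w, ‖ft h w‖ₑ ^ 2 * (‖ft ψ (1 - w.1 / ξ.1, 1 - w.2 / ξ.2)‖ₑ ^ 2 *
        ENNReal.ofReal |detA ξ|⁻¹) ∂mu2 := by
  have hξ' : detA (-ξ) ≠ 0 := by rwa [detA_neg]
  -- Since A_ξ(x-b) = A_{-ξ}(b-x), the transform at ξ is a convolution in b of the modulated signal
  -- with the window dilated by -ξ.
  set H := fun x => chr ξ x * h x with hH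
  set K := fun x => ψ (mulA (-ξ) x) with hK
  have hH1 : MemLp H 1 mu2 := memLp_chr_mul hh1 ξ
  have hH2 : MemLp H 2 mu2 := memLp_chr_mul hh2 ξ
  have hK1 : MemLp K 1 mu2 := memLp_comp_mulA hξ' hψ1
  have hconv (b : ℝ × ℝ) : cStock ψ h (ξ, b) =
      Real.sqrt |detA ξ| • convolution H K (.mul ℂ ℂ) mu2 b := by
    simp only [cStock, convolution, hH, hK, mulA_neg_left, neg_sub,
      ContinuousLinearMap.mul_apply']
  have hc1 : Integrable (convolution H K (.mul ℂ ℂ) mu2) mu2 :=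
    (memLp_one_iff_integrable.1 hH1).integrable_convolution _ (memLp_one_iff_integrable.1 hK1)
  have hS1 : MemLp (fun b => cStock ψ h (ξ, b)) 1 mu2 := by
    simp only [hconv]
    exact memLp_one_iff_integrable.2 (hc1.fun_smul _)
  have hS2 : MemLp (fun b => cStock ψ h (ξ, b)) 2 mu2 :=
    memLp_two_of_integrable_of_bound (memLp_one_iff_integrable.1 hS1)
      (ENNReal.mul_ne_top hh2.2.ne hψ2.2.ne) fun b => enorm_cStock_le hψ2.1 hh2.1 _
  rw [← lintegral_enorm_ft_sq hS1 hS2]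
  have hft (w : ℝ × ℝ) : ‖ft (fun b => cStock ψ h (ξ, b)) w‖ₑ ^ 2 =
      ‖ft h (w + ξ)‖ₑ ^ 2 * (‖ft ψ (1 - (w + ξ).1 / ξ.1, 1 - (w + ξ).2 / ξ.2)‖ₑ ^ 2 *
        ENNReal.ofReal |detA ξ|⁻¹) := by
    have h1 : ft (fun b => cStock ψ h (ξ, b)) w = Real.sqrt |detA ξ| •
        (ft h (w + ξ) * (|detA ξ|⁻¹ • ft ψ (1 - (w + ξ).1 / ξ.1, 1 - (w + ξ).2 / ξ.2))) := by
      have e1 : ft H w = ft h (w + ξ) := ft_chr_mul h ξ w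
      -- Coordinatewise -w/ξ = 1 - (w+ξ)/ξ: this is the source of the shift by 1 in the
      -- admissibility constant.
      have e2 : ft K w = |detA ξ|⁻¹ • ft ψ (1 - (w + ξ).1 / ξ.1, 1 - (w + ξ).2 / ξ.2) := by
        have h1 : ξ.1 ≠ 0 := left_ne_zero_of_mul hξ
        have h2 : ξ.2 ≠ 0 := right_ne_zero_of_mul hξ
        rw [hK, ft_comp_mulA hξ', detA_neg]
        congr 3 <;> simp <;> field_simp <;> ring
      rw [← e1, ← e2, ← ft_convolution (memLp_one_iff_integrable.1 hH1)
        (memLp_one_iff_integrable.1 hK1), ft_eq, ft_eq, ← integral_smul]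
      simp only [hconv, mul_smul_comm]
    rw [h1, enorm_smul, enorm_mul, enorm_smul]
    simp only [mul_pow]
    have : ‖Real.sqrt |detA ξ|‖ₑ ^ 2 * ‖|detA ξ|⁻¹‖ₑ ^ 2 = ENNReal.ofReal |detA ξ|⁻¹ := by
      rw [Real.enorm_eq_ofReal (by positivity), Real.enorm_eq_ofReal (by positivity),
        ← ENNReal.ofReal_pow (by positivity), ← ENNReal.ofReal_pow (by positivity),
        ← ENNReal.ofReal_mul (by positivity), Real.sq_sqrt (abs_nonneg _)]
      congr 1
      have := abs_ne_zero.2 hξ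
      field_simp
    rw [← this]
    ring
  simp only [hft]
  exact lintegral_add_right_eq_self (fun w => ‖ft h w‖ₑ ^ 2 *
    (‖ft ψ (1 - w.1 / ξ.1, 1 - w.2 / ξ.2)‖ₑ ^ 2 * ENNReal.ofReal |detA ξ|⁻¹)) ξ

end ComplexStockwell

/-! ### Invariance of dξ/|det A_ξ| under inversion -/

section ChangeOfVariables

/-- The measure `dx / |x|` is invariant under `x ↦ ω / x`. -/
theorem lintegral_div_abs_inv {ω : ℝ} (hω : ω ≠ 0) (F : ℝ → ℝ≥0∞) :
    ∫⁻ x, F (ω / x) * ENNReal.ofReal |x|⁻¹ = ∫⁻ s, F s * ENNReal.ofReal |s|⁻¹ := by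
  have hs : MeasurableSet ({0}ᶜ : Set ℝ) := (measurableSet_singleton 0).compl
  have hd : ∀ x ∈ ({0}ᶜ : Set ℝ), HasDerivWithinAt (fun x : ℝ => ω / x) (ω * -(x ^ 2)⁻¹) {0}ᶜ x :=
    fun x hx => by
      simpa only [div_eq_mul_inv] using ((hasDerivAt_inv hx).const_mul ω).hasDerivWithinAt
  have hinj : Set.InjOn (fun x : ℝ => ω / x) {0}ᶜ := fun x hx y hy h => by
    have hx' : x ≠ 0 := hx
    have hy' : y ≠ 0 := hy
    have h' : ω / x = ω / y := h
    rw [div_eq_div_iff hx' hy'] at h'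
    exact (mul_left_cancel₀ hω h').symm
  have himg : (fun x : ℝ => ω / x) '' {0}ᶜ = {0}ᶜ := by
    ext y
    constructor
    · rintro ⟨x, hx, rfl⟩
      exact div_ne_zero hω hx
    · intro hy
      have hy' : y ≠ 0 := hy
      exact ⟨ω / y, div_ne_zero hω hy, by simp only; field_simp⟩
  have hae : ({0}ᶜ : Set ℝ) =ᵐ[volume] Set.univ := by
    rw [ae_eq_univ, compl_compl]; exact Real.volume_singleton
  have key := lintegral_image_eq_lintegral_abs_deriv_mul hs hd hinj
    (fun s => F s * ENNReal.ofReal |s|⁻¹)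
  rw [himg] at key
  rw [← setLIntegral_univ, ← setLIntegral_univ (fun s => F s * ENNReal.ofReal |s|⁻¹),
    ← setLIntegral_congr hae, ← setLIntegral_congr hae, key]
  refine setLIntegral_congr_fun hs fun x hx => ?_
  have hx' : x ≠ 0 := hx
  -- The Jacobian |ω|/x² times the weight |ω/x|⁻¹ is |x|⁻¹.
  rw [mul_left_comm, ← ENNReal.ofReal_mul (abs_nonneg _), ← abs_inv, ← abs_inv (ω / x), ← abs_mul]
  congr 2
  rw [inv_div, mul_neg, neg_mul, abs_neg]
  congr 1
  field_simp

theorem lintegral_div_detA_inv {ω : ℝ × ℝ} (hω : detA ω ≠ 0) {F : ℝ × ℝ → ℝ≥0∞}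
    (hF : Measurable F) :
    ∫⁻ ξ, F (ω.1 / ξ.1, ω.2 / ξ.2) * ENNReal.ofReal |detA ξ|⁻¹ ∂mu2 =
      ∫⁻ s, F s * ENNReal.ofReal |detA s|⁻¹ ∂mu2 := by
  have h1 : ω.1 ≠ 0 := left_ne_zero_of_mul hω
  have h2 : ω.2 ≠ 0 := right_ne_zero_of_mul hω
  have hdet (x y : ℝ) : ENNReal.ofReal |detA (x, y)|⁻¹ =
      ENNReal.ofReal |y|⁻¹ * ENNReal.ofReal |x|⁻¹ := by
    rw [← ENNReal.ofReal_mul (by positivity), detA, abs_mul, mul_inv, mul_comm]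
  have hdm : Measurable fun ξ : ℝ × ℝ => ENNReal.ofReal |detA ξ|⁻¹ := by
    unfold detA; fun_prop
  have hG : Measurable fun ξ : ℝ × ℝ => F (ω.1 / ξ.1, ω.2 / ξ.2) :=
    hF.comp (by fun_prop)
  rw [lintegral_mu2, lintegral_mu2, Measure.volume_eq_prod, lintegral_prod _ (hG.fun_mul hdm).aemeasurable,
    lintegral_prod _ (hF.fun_mul hdm).aemeasurable]
  congr 1
  simp only [hdet, ← mul_assoc]
  have e1 (x : ℝ) : ∫⁻ y, F (ω.1 / x, ω.2 / y) * ENNReal.ofReal |y|⁻¹ * ENNReal.ofReal |x|⁻¹ =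
      (∫⁻ y, F (ω.1 / x, y) * ENNReal.ofReal |y|⁻¹) * ENNReal.ofReal |x|⁻¹ := by
    rw [lintegral_mul_const' _ _ ENNReal.ofReal_ne_top,
      lintegral_div_abs_inv h2 fun y => F (ω.1 / x, y)]
  have e2 (x : ℝ) : ∫⁻ y, F (x, y) * ENNReal.ofReal |y|⁻¹ * ENNReal.ofReal |x|⁻¹ =
      (∫⁻ y, F (x, y) * ENNReal.ofReal |y|⁻¹) * ENNReal.ofReal |x|⁻¹ :=
    lintegral_mul_const' _ _ ENNReal.ofReal_ne_top
  simp only [e1, e2]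
  exact lintegral_div_abs_inv h1 fun x => ∫⁻ y, F (x, y) * ENNReal.ofReal |y|⁻¹

theorem ae_detA_ne_zero : ∀ᵐ ξ ∂mu2, detA ξ ≠ 0 := by
  rw [ae_mu2_iff]
  have h0 : ∀ᵐ x : ℝ, x ≠ 0 := by simp [ae_iff]
  have h1 : ∀ᵐ ξ : ℝ × ℝ, ξ.1 ≠ 0 := Measure.quasiMeasurePreserving_fst.ae h0
  have h2 : ∀ᵐ ξ : ℝ × ℝ, ξ.2 ≠ 0 := Measure.quasiMeasurePreserving_snd.ae h0
  filter_upwards [h1, h2] with ξ a b using mul_ne_zero a b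

theorem mu4_eq_prod : mu4 = mu2.prod mu2 := by
  rw [mu4, mu2_eq_smul, Measure.prod_smul_left, Measure.prod_smul_right, smul_smul,
    ← ENNReal.ofReal_mul (by positivity), ← Measure.volume_eq_prod]
  congr 2
  field_simp

end ChangeOfVariables

/-! ### Measurability and Plancherel for the scalar transform on L¹ ∩ L² -/

section ComplexStockwell

/-- Equality at every z permits strongly measurable representatives in the joint measurability
proof. -/
theorem cStock_congr {ψ ψ' h h' : ℝ × ℝ → ℂ} (hψ : ψ =ᵐ[mu2] ψ') (hh : h =ᵐ[mu2] h') :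
    cStock ψ h = cStock ψ' h' := by
  ext1 z
  by_cases hz : detA z.1 = 0
  · simp [cStock, hz]
  · rw [cStock, cStock]
    congr 1
    refine integral_congr_ae ?_
    filter_upwards [hh, (quasiMeasurePreserving_mulA_sub hz z.2).ae hψ] with x hx hx'
    rw [hx, hx']

theorem stronglyMeasurable_cStock {ψ h : ℝ × ℝ → ℂ} (hψ : AEStronglyMeasurable ψ mu2)
    (hh : AEStronglyMeasurable h mu2) : StronglyMeasurable (cStock ψ h) := by
  rw [cStock_congr hψ.ae_eq_mk hh.ae_eq_mk]
  have m1 := hψ.stronglyMeasurable_mk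
  have m2 := hh.stronglyMeasurable_mk
  have md : StronglyMeasurable fun z : (ℝ × ℝ) × (ℝ × ℝ) => Real.sqrt |detA z.1| := by
    unfold detA
    exact Continuous.stronglyMeasurable (by fun_prop)
  refine md.smul (StronglyMeasurable.integral_prod_right (f := fun
    (z : (ℝ × ℝ) × (ℝ × ℝ)) x => chr z.1 x * hh.mk h x * hψ.mk ψ (mulA z.1 (x - z.2))) ?_)
  refine StronglyMeasurable.mul (StronglyMeasurable.mul ?_ ?_) ?_
  · exact (continuous_chr.comp (by fun_prop : Continuous fun p : ((ℝ × ℝ) × (ℝ × ℝ)) × (ℝ × ℝ) =>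
      (p.1.1, p.2))).stronglyMeasurable
  · exact m2.comp_measurable measurable_snd
  · refine m1.comp_measurable ?_
    unfold mulA
    exact Continuous.measurable (by fun_prop)

/-- The admissibility constant of the analysing function `ψ`. -/
noncomputable def cAdm (ψ : ℝ × ℝ → ℂ) : ℝ≥0∞ :=
  ∫⁻ s, ‖ft ψ (1 - s.1, 1 - s.2)‖ₑ ^ 2 * ENNReal.ofReal |detA s|⁻¹ ∂mu2

/-- Plancherel's theorem for the scalar Stockwell transform on `L¹ ∩ L²`. -/
theorem lintegral_cStock_sq_of_memLp_one {ψ h : ℝ × ℝ → ℂ} (hψ1 : MemLp ψ 1 mu2)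
    (hψ2 : MemLp ψ 2 mu2) (hh1 : MemLp h 1 mu2) (hh2 : MemLp h 2 mu2) :
    ∫⁻ z, ‖cStock ψ h z‖ₑ ^ 2 ∂mu4 = cAdm ψ * ∫⁻ x, ‖h x‖ₑ ^ 2 ∂mu2 := by
  have cψ := continuous_ft (memLp_one_iff_integrable.1 hψ1)
  have ch := continuous_ft (memLp_one_iff_integrable.1 hh1)
  have hdm : Measurable fun ξ : ℝ × ℝ => ENNReal.ofReal |detA ξ|⁻¹ := by
    unfold detA; fun_prop
  have hF : Measurable fun s : ℝ × ℝ => ‖ft ψ (1 - s.1, 1 - s.2)‖ₑ ^ 2 :=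
    (cψ.comp (by fun_prop : Continuous fun s : ℝ × ℝ =>
      (1 - s.1, 1 - s.2))).measurable.enorm.pow_const 2
  have hG : Measurable fun p : (ℝ × ℝ) × (ℝ × ℝ) => ‖ft h p.2‖ₑ ^ 2 *
      (‖ft ψ (1 - p.2.1 / p.1.1, 1 - p.2.2 / p.1.2)‖ₑ ^ 2 * ENNReal.ofReal |detA p.1|⁻¹) :=
    ((ch.measurable.comp measurable_snd).enorm.pow_const 2).mul
      ((hF.comp (by fun_prop : Measurable fun p : (ℝ × ℝ) × (ℝ × ℝ) =>
        (p.2.1 / p.1.1, p.2.2 / p.1.2))).mul (hdm.comp measurable_fst))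
  have hS := (stronglyMeasurable_cStock hψ1.1 hh1.1).measurable.enorm.pow_const 2
  rw [mu4_eq_prod, lintegral_prod _ hS.aemeasurable]
  calc ∫⁻ ξ, ∫⁻ b, ‖cStock ψ h (ξ, b)‖ₑ ^ 2 ∂mu2 ∂mu2
      = ∫⁻ ξ, ∫⁻ w, ‖ft h w‖ₑ ^ 2 * (‖ft ψ (1 - w.1 / ξ.1, 1 - w.2 / ξ.2)‖ₑ ^ 2 *
        ENNReal.ofReal |detA ξ|⁻¹) ∂mu2 ∂mu2 := by
        refine lintegral_congr_ae ?_
        filter_upwards [ae_detA_ne_zero] with ξ hξ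
        exact lintegral_cStock_sq_of_detA_ne_zero hψ1 hψ2 hh1 hh2 hξ
    _ = ∫⁻ w, ∫⁻ ξ, ‖ft h w‖ₑ ^ 2 * (‖ft ψ (1 - w.1 / ξ.1, 1 - w.2 / ξ.2)‖ₑ ^ 2 *
        ENNReal.ofReal |detA ξ|⁻¹) ∂mu2 ∂mu2 := lintegral_lintegral_swap hG.aemeasurable
    -- For almost every w the substitution s = w/ξ removes w from the inner integral, leaving the
    -- constant.
    _ = ∫⁻ w, cAdm ψ * ‖ft h w‖ₑ ^ 2 ∂mu2 := by
        refine lintegral_congr_ae ?_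
        filter_upwards [ae_detA_ne_zero] with w hw
        rw [lintegral_const_mul' _ _ (by finiteness), cAdm, lintegral_div_detA_inv hw hF, mul_comm]
    _ = _ := by
        rw [lintegral_const_mul _ (ch.measurable.enorm.pow_const 2),
          lintegral_enorm_ft_sq hh1 hh2]

end ComplexStockwell

/-! ### Extension of scalar Plancherel to L² -/

section Extension

open Filter Topology

theorem cStock_sub {ψ h h' : ℝ × ℝ → ℂ} (hψ : MemLp ψ 2 mu2) (hh : MemLp h 2 mu2)
    (hh' : MemLp h' 2 mu2) : cStock ψ (h - h') = cStock ψ h - cStock ψ h' := by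
  ext1 z
  by_cases hz : detA z.1 = 0
  · simp [cStock, hz]
  · have hm := memLp_comp_mulA_sub hz z.2 hψ
    rw [Pi.sub_apply, cStock, cStock, cStock, ← smul_sub, ← integral_sub
      (integrable_mul_of_memLp_two (memLp_chr_mul hh z.1) hm)
      (integrable_mul_of_memLp_two (memLp_chr_mul hh' z.1) hm)]
    congr 2
    ext1 x
    simp only [Pi.sub_apply]
    ring

theorem eLpNorm_cStock_of_memLp_one {ψ h : ℝ × ℝ → ℂ} (hψ1 : MemLp ψ 1 mu2)
    (hψ2 : MemLp ψ 2 mu2) (hh1 : MemLp h 1 mu2) (hh2 : MemLp h 2 mu2) :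
    eLpNorm (cStock ψ h) 2 mu4 = cAdm ψ ^ (1 / 2 : ℝ) * eLpNorm h 2 mu2 := by
  refine (ENNReal.pow_right_strictMono two_ne_zero).injective ?_
  rw [mul_pow, eLpNorm_two_sq, eLpNorm_two_sq, lintegral_cStock_sq_of_memLp_one hψ1 hψ2 hh1 hh2,
    ← ENNReal.rpow_natCast, ← ENNReal.rpow_mul]
  simp

theorem exists_tendsto_eLpNorm_sub {h : ℝ × ℝ → ℂ} (hh : MemLp h 2 mu2) :
    ∃ g : ℕ → ℝ × ℝ → ℂ, (∀ n, MemLp (g n) 1 mu2) ∧ (∀ n, MemLp (g n) 2 mu2) ∧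
      Tendsto (fun n => eLpNorm (h - g n) 2 mu2) atTop (𝓝 0) := by
  -- The tolerance is 1/n, which at n = 0 is ∞ and hence still nonzero.
  have H (n : ℕ) := hh.exists_simpleFunc_eLpNorm_sub_lt ENNReal.ofNat_ne_top
    (ENNReal.inv_ne_zero.2 (ENNReal.natCast_ne_top n))
  choose g hg hg2 using H
  refine ⟨fun n => g n, fun n => ?_, hg2, ?_⟩
  · exact memLp_one_iff_integrable.2
      ((SimpleFunc.memLp_iff_integrable two_ne_zero ENNReal.ofNat_ne_top).1 (hg2 n))
  · exact tendsto_of_tendsto_of_tendsto_of_le_of_le tendsto_const_nhds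
      ENNReal.tendsto_inv_nat_nhds_zero (fun _ => zero_le) fun n => (hg n).le

/-- By Cauchy–Schwarz, evaluation at each z is continuous in the L² signal. Pointwise convergence is
what Fatou needs in `eLpNorm_cStock_le`. -/
theorem tendsto_cStock {ψ h : ℝ × ℝ → ℂ} {g : ℕ → ℝ × ℝ → ℂ} (hψ : MemLp ψ 2 mu2)
    (hh : MemLp h 2 mu2) (hg : ∀ n, MemLp (g n) 2 mu2)
    (hlim : Tendsto (fun n => eLpNorm (h - g n) 2 mu2) atTop (𝓝 0)) (z : (ℝ × ℝ) × (ℝ × ℝ)) :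
    Tendsto (fun n => cStock ψ (g n) z) atTop (𝓝 (cStock ψ h z)) := by
  rw [tendsto_iff_edist_tendsto_0]
  have h0 : Tendsto (fun n => eLpNorm (h - g n) 2 mu2 * eLpNorm ψ 2 mu2) atTop (𝓝 0) := by
    simpa using ENNReal.Tendsto.mul_const hlim (Or.inr hψ.2.ne)
  refine tendsto_of_tendsto_of_tendsto_of_le_of_le tendsto_const_nhds h0 (fun _ => zero_le)
    fun n => ?_
  beta_reduce
  rw [edist_comm, edist_eq_enorm_sub, ← Pi.sub_apply, ← cStock_sub hψ hh (hg n)]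
  exact enorm_cStock_le hψ.1 (hh.sub (hg n)).1 z

theorem eLpNorm_cStock_le {ψ h : ℝ × ℝ → ℂ} (hψ1 : MemLp ψ 1 mu2) (hψ2 : MemLp ψ 2 mu2)
    (hC : cAdm ψ ≠ ∞) (hh : MemLp h 2 mu2) :
    eLpNorm (cStock ψ h) 2 mu4 ≤ cAdm ψ ^ (1 / 2 : ℝ) * eLpNorm h 2 mu2 := by
  obtain ⟨g, g1, g2, hlim⟩ := exists_tendsto_eLpNorm_sub hh
  refine (Lp.eLpNorm_lim_le_liminf_eLpNorm
    (fun n => (stronglyMeasurable_cStock hψ1.1 (g1 n).1).aestronglyMeasurable) _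
    (ae_of_all _ (tendsto_cStock hψ2 hh g2 hlim))).trans ?_
  have hc : cAdm ψ ^ (1 / 2 : ℝ) ≠ ∞ := by finiteness
  have hb (n : ℕ) : eLpNorm (cStock ψ (g n)) 2 mu4 ≤
      cAdm ψ ^ (1 / 2 : ℝ) * (eLpNorm h 2 mu2 + eLpNorm (h - g n) 2 mu2) := by
    rw [eLpNorm_cStock_of_memLp_one hψ1 hψ2 (g1 n) (g2 n)]
    gcongr
    have := eLpNorm_sub_le (p := 2) hh.1 (hh.sub (g2 n)).1 one_le_two
    rwa [sub_sub_cancel] at this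
  have ht : Tendsto (fun n => cAdm ψ ^ (1 / 2 : ℝ) * (eLpNorm h 2 mu2 + eLpNorm (h - g n) 2 mu2))
      atTop (𝓝 (cAdm ψ ^ (1 / 2 : ℝ) * (eLpNorm h 2 mu2 + 0))) :=
    ENNReal.Tendsto.const_mul (tendsto_const_nhds.add hlim) (Or.inr hc)
  rw [add_zero] at ht
  exact (liminf_le_liminf (Eventually.of_forall hb)).trans_eq ht.liminf_eq

/-- Plancherel's theorem for the scalar Stockwell transform on `L²`. -/
theorem lintegral_cStock_sq {ψ h : ℝ × ℝ → ℂ} (hψ1 : MemLp ψ 1 mu2) (hψ2 : MemLp ψ 2 mu2)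
    (hC : cAdm ψ ≠ ∞) (hh : MemLp h 2 mu2) :
    ∫⁻ z, ‖cStock ψ h z‖ₑ ^ 2 ∂mu4 = cAdm ψ * ∫⁻ x, ‖h x‖ₑ ^ 2 ∂mu2 := by
  suffices H : eLpNorm (cStock ψ h) 2 mu4 = cAdm ψ ^ (1 / 2 : ℝ) * eLpNorm h 2 mu2 by
    rw [← eLpNorm_two_sq, ← eLpNorm_two_sq, H, mul_pow, ← ENNReal.rpow_natCast,
      ← ENNReal.rpow_mul]
    simp
  refine le_antisymm (eLpNorm_cStock_le hψ1 hψ2 hC hh) ?_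
  obtain ⟨g, g1, g2, hlim⟩ := exists_tendsto_eLpNorm_sub hh
  set c := cAdm ψ ^ (1 / 2 : ℝ) with hcdef
  have hc : c ≠ ∞ := by rw [hcdef]; finiteness
  have hm {u : ℝ × ℝ → ℂ} (hu : MemLp u 2 mu2) : AEStronglyMeasurable (cStock ψ u) mu4 :=
    (stronglyMeasurable_cStock hψ1.1 hu.1).aestronglyMeasurable
  -- The error `h - g n` is paid twice: once in approximating the signal, once in approximating its
  -- transform, where the upper bound is applied to the error.
  have hb (n : ℕ) : c * eLpNorm h 2 mu2 ≤
      eLpNorm (cStock ψ h) 2 mu4 + 2 * c * eLpNorm (h - g n) 2 mu2 := by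
    have t1 : eLpNorm h 2 mu2 ≤ eLpNorm (g n) 2 mu2 + eLpNorm (h - g n) 2 mu2 := by
      have := eLpNorm_add_le (p := 2) (g2 n).1 (hh.sub (g2 n)).1 one_le_two
      rwa [add_sub_cancel] at this
    have t2 : c * eLpNorm (g n) 2 mu2 ≤ eLpNorm (cStock ψ h) 2 mu4 + c * eLpNorm (h - g n) 2 mu2 := by
      rw [← eLpNorm_cStock_of_memLp_one hψ1 hψ2 (g1 n) (g2 n)]
      have := eLpNorm_sub_le (p := 2) (hm hh) (hm (hh.sub (g2 n))) one_le_two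
      rw [cStock_sub hψ2 hh (g2 n), sub_sub_cancel, ← cStock_sub hψ2 hh (g2 n)] at this
      exact this.trans (add_le_add_right (eLpNorm_cStock_le hψ1 hψ2 hC (hh.sub (g2 n))) _)
    calc c * eLpNorm h 2 mu2 ≤ c * (eLpNorm (g n) 2 mu2 + eLpNorm (h - g n) 2 mu2) := by gcongr
      _ = c * eLpNorm (g n) 2 mu2 + c * eLpNorm (h - g n) 2 mu2 := mul_add _ _ _
      _ ≤ _ := (add_le_add_left t2 _).trans_eq (by ring)
  have ht : Tendsto (fun n => eLpNorm (cStock ψ h) 2 mu4 + 2 * c * eLpNorm (h - g n) 2 mu2)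
      atTop (𝓝 (eLpNorm (cStock ψ h) 2 mu4 + 2 * c * 0)) :=
    tendsto_const_nhds.add (ENNReal.Tendsto.const_mul hlim (Or.inr (by finiteness)))
  rw [mul_zero, add_zero] at ht
  exact ge_of_tendsto' ht hb

end Extension

/-! ### Quaternion exponentials -/

section Exponentials

theorem qi_re : qi.re = 0 := rfl

theorem qi_imI : qi.imI = 1 := rfl

theorem qi_imJ : qi.imJ = 0 := rfl

theorem qi_imK : qi.imK = 0 := rfl

theorem qj_re : qj.re = 0 := rfl

theorem qj_imI : qj.imI = 0 := rfl

theorem qj_imJ : qj.imJ = 1 := rfl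

theorem qj_imK : qj.imK = 0 := rfl

attribute [simp] qi_re qi_imI qi_imJ qi_imK qj_re qj_imI qj_imJ qj_imK

/-- Euler's formula is transported along the algebra map ℂ → ℍ sending the complex unit to `qi`. -/
theorem expI_eq (t : ℝ) : expI t = ⟨Real.cos t, Real.sin t, 0, 0⟩ := by
  have hq : qi * qi = -1 := by ext <;> simp
  have hc : Continuous (Complex.liftAux qi hq) :=
    (Complex.liftAux qi hq).toLinearMap.continuous_of_finiteDimensional
  have h := NormedSpace.map_exp (Complex.liftAux qi hq) hc ((t : ℂ) * Complex.I)
  rw [← Complex.exp_eq_exp_ℂ] at h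
  have e : (Complex.liftAux qi hq) ((t : ℂ) * Complex.I) = t • qi := by
    simp [Complex.liftAux_apply]
  rw [e, Complex.liftAux_apply, Complex.exp_ofReal_mul_I_re, Complex.exp_ofReal_mul_I_im] at h
  rw [expI, ← h]
  ext <;> simp

theorem expJ_eq (t : ℝ) : expJ t = ⟨Real.cos t, 0, Real.sin t, 0⟩ := by
  have hq : qj * qj = -1 := by ext <;> simp
  have hc : Continuous (Complex.liftAux qj hq) :=
    (Complex.liftAux qj hq).toLinearMap.continuous_of_finiteDimensional
  have h := NormedSpace.map_exp (Complex.liftAux qj hq) hc ((t : ℂ) * Complex.I)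
  rw [← Complex.exp_eq_exp_ℂ] at h
  have e : (Complex.liftAux qj hq) ((t : ℂ) * Complex.I) = t • qj := by
    simp [Complex.liftAux_apply]
  rw [e, Complex.liftAux_apply, Complex.exp_ofReal_mul_I_re, Complex.exp_ofReal_mul_I_im] at h
  rw [expJ, ← h]
  ext <;> simp

theorem expI_re (t : ℝ) : (expI t).re = Real.cos t := by rw [expI_eq]

theorem expI_imI (t : ℝ) : (expI t).imI = Real.sin t := by rw [expI_eq]

theorem expI_imJ (t : ℝ) : (expI t).imJ = 0 := by rw [expI_eq]

theorem expI_imK (t : ℝ) : (expI t).imK = 0 := by rw [expI_eq]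

theorem expJ_re (t : ℝ) : (expJ t).re = Real.cos t := by rw [expJ_eq]

theorem expJ_imI (t : ℝ) : (expJ t).imI = 0 := by rw [expJ_eq]

theorem expJ_imJ (t : ℝ) : (expJ t).imJ = Real.sin t := by rw [expJ_eq]

theorem expJ_imK (t : ℝ) : (expJ t).imK = 0 := by rw [expJ_eq]

attribute [simp] expI_re expI_imI expI_imJ expI_imK expJ_re expJ_imI expJ_imJ expJ_imK

theorem norm_quaternion_sq (q : ℍ[ℝ]) :
    ‖q‖ ^ 2 = q.re ^ 2 + q.imI ^ 2 + q.imJ ^ 2 + q.imK ^ 2 := by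
  rw [sq, ← Quaternion.normSq_eq_norm_mul_self, Quaternion.normSq_def']

theorem norm_expI (t : ℝ) : ‖expI t‖ = 1 := by
  have h := norm_quaternion_sq (expI t)
  simp only [expI_re, expI_imI, expI_imJ, expI_imK] at h
  rw [← sq_eq_sq₀ (norm_nonneg _) zero_le_one, h]
  linarith [Real.cos_sq_add_sin_sq t]

theorem norm_expJ (t : ℝ) : ‖expJ t‖ = 1 := by
  have h := norm_quaternion_sq (expJ t)
  simp only [expJ_re, expJ_imI, expJ_imJ, expJ_imK] at h
  rw [← sq_eq_sq₀ (norm_nonneg _) zero_le_one, h]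
  linarith [Real.cos_sq_add_sin_sq t]

theorem continuous_expI : Continuous expI := by
  have : expI = fun t => Real.cos t • (1 : ℍ[ℝ]) + Real.sin t • qi := by
    ext t <;> simp
  rw [this]
  fun_prop

theorem continuous_expJ : Continuous expJ := by
  have : expJ = fun t => Real.cos t • (1 : ℍ[ℝ]) + Real.sin t • qj := by
    ext t <;> simp
  rw [this]
  fun_prop

end Exponentials

/-! ### Splitting ℍ into two complex lines -/

section Components

/-- The coordinate `(q₀ - q₃) + (q₁ + q₂) i` of a quaternion, which intertwines left
multiplication by `i` and right multiplication by `j` with multiplication by the complex unit. -/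
noncomputable def projM : ℍ[ℝ] →L[ℝ] ℂ :=
  LinearMap.toContinuousLinearMap
    { toFun := fun q => ⟨q.re - q.imK, q.imI + q.imJ⟩
      map_add' := fun p q => by apply Complex.ext <;> simp <;> ring
      map_smul' := fun r q => by apply Complex.ext <;> simp <;> ring }

/-- The coordinate `(q₀ + q₃) + (q₂ - q₁) i` of a quaternion, which intertwines left
multiplication by `-i` and right multiplication by `j` with multiplication by the complex unit. -/
noncomputable def projP : ℍ[ℝ] →L[ℝ] ℂ :=
  LinearMap.toContinuousLinearMap
    { toFun := fun q => ⟨q.re + q.imK, q.imJ - q.imI⟩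
      map_add' := fun p q => by apply Complex.ext <;> simp <;> ring
      map_smul' := fun r q => by apply Complex.ext <;> simp <;> ring }

theorem projM_apply (q : ℍ[ℝ]) : projM q = ⟨q.re - q.imK, q.imI + q.imJ⟩ := rfl

theorem projP_apply (q : ℍ[ℝ]) : projP q = ⟨q.re + q.imK, q.imJ - q.imI⟩ := rfl

theorem norm_sq_eq_projP_projM (q : ℍ[ℝ]) :
    ‖q‖ ^ 2 = (‖projP q‖ ^ 2 + ‖projM q‖ ^ 2) / 2 := by
  rw [norm_quaternion_sq, Complex.sq_norm, Complex.sq_norm, Complex.normSq_apply,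
    Complex.normSq_apply, projP_apply, projM_apply]
  ring

theorem enorm_sq_eq_projP_projM (q : ℍ[ℝ]) :
    ‖q‖ₑ ^ 2 = 2⁻¹ * (‖projP q‖ₑ ^ 2 + ‖projM q‖ₑ ^ 2) := by
  simp only [← ofReal_norm, ← ENNReal.ofReal_pow (norm_nonneg _)]
  rw [← ENNReal.ofReal_add (by positivity) (by positivity), norm_sq_eq_projP_projM, div_eq_inv_mul,
    ENNReal.ofReal_mul (by positivity), ENNReal.ofReal_inv_of_pos two_pos]
  simp

theorem exp_neg_ofReal_mul_I (t : ℝ) :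
    Complex.exp (-(t * Complex.I)) = ⟨Real.cos t, -Real.sin t⟩ := by
  rw [← neg_mul, ← Complex.ofReal_neg]
  apply Complex.ext
  · rw [Complex.exp_ofReal_mul_I_re, Real.cos_neg]
  · rw [Complex.exp_ofReal_mul_I_im, Real.sin_neg]

theorem projM_expI_mul_mul_expJ (s t : ℝ) (q : ℍ[ℝ]) :
    projM (expI (-s) * q * expJ (-t)) = Complex.exp (-((s + t : ℝ) * Complex.I)) * projM q := by
  rw [Complex.ofReal_add, add_mul, neg_add, Complex.exp_add, exp_neg_ofReal_mul_I,
    exp_neg_ofReal_mul_I, projM_apply, projM_apply]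
  apply Complex.ext <;> simp <;> ring

theorem projP_expI_mul_mul_expJ (s t : ℝ) (q : ℍ[ℝ]) :
    projP (expI (-s) * q * expJ (-t)) = Complex.exp (-((-s + t : ℝ) * Complex.I)) * projP q := by
  rw [Complex.ofReal_add, add_mul, neg_add, Complex.exp_add, exp_neg_ofReal_mul_I,
    exp_neg_ofReal_mul_I, projP_apply, projP_apply]
  apply Complex.ext <;> simp <;> ring

/-- The hypothesis says q = a + bj, and right multiplication by j is multiplication by the complex
unit in this coordinate. -/
theorem projM_mul_of_eq (p : ℍ[ℝ]) {q : ℍ[ℝ]} (hq : projP q = projM q) :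
    projM (p * q) = projM p * projM q := by
  simp only [projM_apply, projP_apply, Complex.mk.injEq] at hq
  have h1 : q.imI = 0 := by linarith [hq.2]
  have h3 : q.imK = 0 := by linarith [hq.1]
  simp only [projM_apply]
  apply Complex.ext <;> simp [h1, h3] <;> ring

theorem projP_mul_of_eq (p : ℍ[ℝ]) {q : ℍ[ℝ]} (hq : projP q = projM q) :
    projP (p * q) = projP p * projM q := by
  simp only [projM_apply, projP_apply, Complex.mk.injEq] at hq
  have h1 : q.imI = 0 := by linarith [hq.2]
  have h3 : q.imK = 0 := by linarith [hq.1]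
  simp only [projM_apply, projP_apply]
  apply Complex.ext <;> simp [h1, h3] <;> ring

/-- Left multiplication by j anticommutes with left multiplication by i, so it exchanges the two
lines. -/
theorem projM_qj_mul (q : ℍ[ℝ]) : projM (qj * q) = Complex.I * projP q := by
  rw [projM_apply, projP_apply]
  apply Complex.ext <;> simp <;> ring

theorem projP_star_eq {q : ℍ[ℝ]} (hq : projP q = projM q) : projP (star q) = projM (star q) := by
  simp only [projM_apply, projP_apply, Complex.mk.injEq] at hq
  have h1 : q.imI = 0 := by linarith [hq.2]
  have h3 : q.imK = 0 := by linarith [hq.1]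
  simp [projM_apply, projP_apply, h1, h3]

theorem projP_eq_projM_of_commute {q : ℍ[ℝ]} (h : q * qj = qj * q) : projP q = projM q := by
  have h1 := congrArg QuaternionAlgebra.imI h
  have h3 := congrArg QuaternionAlgebra.imK h
  simp at h1 h3
  rw [projP_apply, projM_apply]
  apply Complex.ext <;> simp <;> linarith

end Components

/-! ### What the convolution condition says about the window -/

section QuaternionFourier

theorem memLp_expI_mul_mul_expJ {f : ℝ × ℝ → ℍ[ℝ]} {p : ℝ≥0∞} (hf : MemLp f p mu2) (u v : ℝ) :
    MemLp (fun x => expI (-(x.1 * u)) * f x * expJ (-(x.2 * v))) p mu2 := by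
  refine hf.of_le ?_ (ae_of_all _ fun x => by
    rw [norm_mul, norm_mul, norm_expI, norm_expJ, one_mul, mul_one])
  exact ((continuous_expI.comp (by fun_prop)).aestronglyMeasurable.mul hf.1).mul
    (continuous_expJ.comp (by fun_prop)).aestronglyMeasurable

theorem projM_qft {g : ℝ × ℝ → ℍ[ℝ]} (hg : MemLp g 1 mu2) (w : ℝ × ℝ) :
    projM (qft g w) = ft (fun x => projM (g x)) w := by
  rw [qft, ← ContinuousLinearMap.integral_comp_comm _
    (memLp_one_iff_integrable.1 (memLp_expI_mul_mul_expJ hg w.1 w.2))]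
  simp only [projM_expI_mul_mul_expJ]
  rfl

theorem projP_qft {g : ℝ × ℝ → ℍ[ℝ]} (hg : MemLp g 1 mu2) (w : ℝ × ℝ) :
    projP (qft g w) = ft (fun x => projP (g x)) (-w.1, w.2) := by
  rw [qft, ← ContinuousLinearMap.integral_comp_comm _
    (memLp_one_iff_integrable.1 (memLp_expI_mul_mul_expJ hg w.1 w.2))]
  simp only [projP_expI_mul_mul_expJ, ft, mul_neg]

theorem ae_eq_of_ft_ae_eq {g h : ℝ × ℝ → ℂ} (hg1 : MemLp g 1 mu2) (hg2 : MemLp g 2 mu2)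
    (hh1 : MemLp h 1 mu2) (hh2 : MemLp h 2 mu2) (H : ft g =ᵐ[mu2] ft h) : g =ᵐ[mu2] h := by
  have hP := lintegral_enorm_ft_sq (hg1.sub hh1) (hg2.sub hh2)
  have h0 : ∫⁻ w, ‖ft (g - h) w‖ₑ ^ 2 ∂mu2 = 0 := by
    rw [← lintegral_zero (μ := mu2)]
    refine lintegral_congr_ae ?_
    filter_upwards [H] with w hw
    have : ft (g - h) w = ft g w - ft h w := by
      rw [ft_eq, ft_eq, ft_eq, ← integral_sub
        (memLp_one_iff_integrable.1 (memLp_chr_mul hg1 w))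
        (memLp_one_iff_integrable.1 (memLp_chr_mul hh1 w))]
      simp only [Pi.sub_apply, mul_sub]
    rw [this, hw, sub_self]
    simp
  rw [h0, ← eLpNorm_two_sq, eq_comm, sq_eq_zero_iff,
    eLpNorm_eq_zero_iff (hg2.sub hh2).1 two_ne_zero] at hP
  filter_upwards [hP] with x hx
  exact sub_eq_zero.1 hx

theorem ft_comp_reflect (g : ℝ × ℝ → ℂ) (w : ℝ × ℝ) :
    ft (fun x => g (mulA (-1, 1) x)) w = ft g (-w.1, w.2) := by
  rw [ft_comp_mulA (by simp [detA])]
  simp [detA, div_neg]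

variable {φ : ℝ × ℝ → ℍ[ℝ]}

/-- At y = 0 the second condition reads F_Q(jφ) = j F_Q(φ). Its `projM` coordinate compares the
`projP` part at u (left j inside the integral) with its value at -u (left j outside). -/
theorem ft_projP_reflect (h1 : MemLp φ 1 mu2) (hconv : ConvolutionCondition φ) (u v : ℝ) :
    ft (fun x => projP (φ x)) (u, v) = ft (fun x => projP (φ x)) (-u, v) := by
  have hj : MemLp (fun x => qj * φ x) 1 mu2 := h1.const_mul qj
  have e := congrArg projM (hconv u v 0).2
  have e0 : expJ (-(v * 0)) = 1 := by simp [expJ]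
  rw [e0, mul_one, mul_one, projM_qft hj, projM_qj_mul, projP_qft h1] at e
  simp only [projM_qj_mul] at e
  rw [ft_eq] at e
  simp only [mul_left_comm _ Complex.I] at e
  rw [integral_const_mul] at e
  exact mul_left_cancel₀ Complex.I_ne_zero e

theorem ft_projP_eq_ft_projM (h1 : MemLp φ 1 mu2) (hconv : ConvolutionCondition φ) (u : ℝ)
    {v : ℝ} (hv : v ≠ 0) :
    ft (fun x => projP (φ x)) (u, v) = ft (fun x => projM (φ x)) (u, v) := by
  -- This y makes exp(-jvy) = j, so F_Q(φ)(u,v) commutes with j and lies in ℝ+ℝj.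
  have e := (hconv u v (-(Real.pi / 2) / v)).1
  have e0 : expJ (-(v * (-(Real.pi / 2) / v))) = qj := by
    rw [mul_div_cancel₀ _ hv, neg_neg, expJ_eq, Real.cos_pi_div_two, Real.sin_pi_div_two, qj]
  rw [e0] at e
  have := projP_eq_projM_of_commute e
  rw [projP_qft h1, projM_qft h1] at this
  rw [ft_projP_reflect h1 hconv]
  exact this

theorem projP_ae_eq_projM (h1 : MemLp φ 1 mu2) (h2 : MemLp φ 2 mu2)
    (hconv : ConvolutionCondition φ) :
    (fun x => projP (φ x)) =ᵐ[mu2] fun x => projM (φ x) := by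
  refine ae_eq_of_ft_ae_eq (projP.comp_memLp' h1) (projP.comp_memLp' h2) (projM.comp_memLp' h1)
    (projM.comp_memLp' h2) ?_
  filter_upwards [ae_detA_ne_zero] with w hw
  exact ft_projP_eq_ft_projM h1 hconv w.1 (right_ne_zero_of_mul hw)

theorem projP_reflect_ae_eq (h1 : MemLp φ 1 mu2) (h2 : MemLp φ 2 mu2)
    (hconv : ConvolutionCondition φ) :
    (fun x => projP (φ (mulA (-1, 1) x))) =ᵐ[mu2] fun x => projP (φ x) := by
  have hd : detA (-1, 1) ≠ 0 := by simp [detA]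
  have p1 := projP.comp_memLp' h1
  have p2 := projP.comp_memLp' h2
  refine ae_eq_of_ft_ae_eq (memLp_comp_mulA hd p1) (memLp_comp_mulA hd p2) p1 p2
    (ae_of_all _ fun w => ?_)
  exact (ft_comp_reflect (fun x => projP (φ x)) w).trans (ft_projP_reflect h1 hconv w.1 w.2).symm

end QuaternionFourier

/-! ### Decoupling and Plancherel for the quaternion Stockwell transform -/

section QuaternionStockwell

variable {φ f : ℝ × ℝ → ℍ[ℝ]}

theorem projP_star_ae_eq (h1 : MemLp φ 1 mu2) (h2 : MemLp φ 2 mu2)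
    (hconv : ConvolutionCondition φ) :
    ∀ᵐ x ∂mu2, projP (star (φ x)) = projM (star (φ x)) := by
  filter_upwards [projP_ae_eq_projM h1 h2 hconv] with x hx using projP_star_eq hx

theorem projM_star_reflect_ae_eq (h1 : MemLp φ 1 mu2) (h2 : MemLp φ 2 mu2)
    (hconv : ConvolutionCondition φ) :
    ∀ᵐ x ∂mu2, projM (star (φ (mulA (-1, 1) x))) = projM (star (φ x)) := by
  have hd : detA (-1, 1) ≠ 0 := by simp [detA]
  have hP := projP_ae_eq_projM h1 h2 hconv
  filter_upwards [projP_reflect_ae_eq h1 h2 hconv, hP, (quasiMeasurePreserving_mulA hd).ae hP]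
    with x hx hx1 hx2
  have hstar {q : ℍ[ℝ]} (hq : projP q = projM q) : projM (star q) = star (projP q) := by
    simp only [projM_apply, projP_apply, Complex.mk.injEq] at hq
    simp only [projM_apply, projP_apply]
    apply Complex.ext <;> simp
    linarith [hq.1, hq.2]
  rw [hstar hx1, hstar hx2, hx]

theorem memLp_star {p : ℝ≥0∞} (h : MemLp φ p mu2) : MemLp (fun x => star (φ x)) p mu2 :=
  h.of_le (continuous_star.comp_aestronglyMeasurable h.1) (ae_of_all _ fun _ => (norm_star _).le)

/-- Evenness of the window absorbs the reflected first frequency in the `projP` coordinate, so both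
coordinates of the quaternion transform coincide. -/
theorem admConst_eq_cAdm (h1 : MemLp φ 1 mu2) (h2 : MemLp φ 2 mu2)
    (hconv : ConvolutionCondition φ) :
    admConst φ = cAdm (fun x => projM (star (φ x))) := by
  have hs := memLp_star h1
  refine lintegral_congr fun ξ => ?_
  have hP : projP (qft (fun x => star (φ x)) (1 - ξ.1, 1 - ξ.2)) =
      ft (fun x => projM (star (φ x))) (1 - ξ.1, 1 - ξ.2) := by
    rw [projP_qft hs, ← ft_comp_reflect, ft_eq, ft_eq]
    have hd : detA (-1, 1) ≠ 0 := by simp [detA]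
    refine integral_congr_ae ?_
    filter_upwards [projM_star_reflect_ae_eq h1 h2 hconv,
      (quasiMeasurePreserving_mulA hd).ae (projP_star_ae_eq h1 h2 hconv)] with x hx hx'
    rw [hx', hx]
  rw [div_eq_mul_inv, ENNReal.ofReal_mul (by positivity), norm_sq_eq_projP_projM, hP,
    projM_qft hs, add_self_div_two, ENNReal.ofReal_pow (norm_nonneg _), ofReal_norm]

theorem integrable_stockwell (h2 : MemLp φ 2 mu2) (hf : MemLp f 2 mu2)
    {z : (ℝ × ℝ) × (ℝ × ℝ)} (hz : detA z.1 ≠ 0) :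
    Integrable (fun x => expI (-(x.1 * z.1.1)) * f x * expJ (-(x.2 * z.1.2)) *
      star (φ (mulA z.1 (x - z.2)))) mu2 :=
  integrable_mul_of_memLp_two (memLp_expI_mul_mul_expJ hf _ _)
    (memLp_comp_mulA_sub hz z.2 (memLp_star h2))

theorem projM_stockwell (h1 : MemLp φ 1 mu2) (h2 : MemLp φ 2 mu2)
    (hconv : ConvolutionCondition φ) (hf : MemLp f 2 mu2) (z : (ℝ × ℝ) × (ℝ × ℝ)) :
    projM (stockwell φ f z) =
      cStock (fun x => projM (star (φ x))) (fun x => projM (f x)) z := by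
  by_cases hz : detA z.1 = 0
  · simp [stockwell, cStock, hz]
  rw [stockwell, cStock, map_smul,
    ← ContinuousLinearMap.integral_comp_comm _ (integrable_stockwell h2 hf hz)]
  congr 1
  refine integral_congr_ae ?_
  filter_upwards [(quasiMeasurePreserving_mulA_sub hz z.2).ae (projP_star_ae_eq h1 h2 hconv)]
    with x hx
  rw [projM_mul_of_eq _ hx, projM_expI_mul_mul_expJ, chr]

theorem projP_stockwell (h1 : MemLp φ 1 mu2) (h2 : MemLp φ 2 mu2)
    (hconv : ConvolutionCondition φ) (hf : MemLp f 2 mu2) (z : (ℝ × ℝ) × (ℝ × ℝ)) :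
    projP (stockwell φ f z) =
      cStock (fun x => projM (star (φ x))) (fun x => projP (f x)) (mulA (-1, 1) z.1, z.2) := by
  by_cases hz : detA z.1 = 0
  · have : detA (mulA (-1, 1) z.1) = 0 := by simpa [detA, mulA] using hz
    simp [stockwell, cStock, hz, this]
  have hdet : |detA (mulA (-1, 1) z.1)| = |detA z.1| := by simp [detA, mulA, abs_mul]
  rw [stockwell, cStock, map_smul,
    ← ContinuousLinearMap.integral_comp_comm _ (integrable_stockwell h2 hf hz), hdet]
  congr 1
  refine integral_congr_ae ?_
  have hq := quasiMeasurePreserving_mulA_sub hz z.2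
  filter_upwards [hq.ae (projP_star_ae_eq h1 h2 hconv),
    hq.ae (projM_star_reflect_ae_eq h1 h2 hconv)] with x hx hx'
  -- The `projP` coordinate reverses ξ₁ in the character; evenness of the window reverses it in the
  -- dilation as well.
  have hA : mulA (-1, 1) (mulA z.1 (x - z.2)) = mulA (mulA (-1, 1) z.1) (x - z.2) := by
    simp [mulA]
  rw [hA] at hx'
  rw [projP_mul_of_eq _ hx, projP_expI_mul_mul_expJ, chr, ← hx']
  simp [mulA]

theorem lintegral_enorm_sq_eq_projP_projM (hf : MemLp f 2 mu2) :
    ∫⁻ x, ‖f x‖ₑ ^ 2 ∂mu2 =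
      2⁻¹ * (∫⁻ x, ‖projP (f x)‖ₑ ^ 2 ∂mu2 + ∫⁻ x, ‖projM (f x)‖ₑ ^ 2 ∂mu2) := by
  simp only [enorm_sq_eq_projP_projM]
  rw [lintegral_const_mul' _ _ (by simp),
    lintegral_add_left' ((projP.continuous.comp_aestronglyMeasurable hf.1).enorm.pow_const 2)]

theorem lintegral_comp_reflect {F : (ℝ × ℝ) × (ℝ × ℝ) → ℝ≥0∞} (hF : Measurable F) :
    ∫⁻ z, F (mulA (-1, 1) z.1, z.2) ∂mu4 = ∫⁻ z, F z ∂mu4 := by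
  have hd : detA (-1, 1) ≠ 0 := by simp [detA]
  have hm : Measurable fun z : (ℝ × ℝ) × (ℝ × ℝ) => F (mulA (-1, 1) z.1, z.2) :=
    hF.comp (((mulA_measurableEmbedding hd).measurable.comp measurable_fst).prodMk measurable_snd)
  rw [mu4_eq_prod, lintegral_prod _ hm.aemeasurable, lintegral_prod _ hF.aemeasurable,
    lintegral_comp_mulA hd fun ξ => ∫⁻ b, F (ξ, b) ∂mu2]
  simp [detA]

/-- Plancherel's theorem for the quaternion Stockwell transform. -/
theorem lintegral_stockwell_sq (hφ : IsAdmissibleWindow φ) (hconv : ConvolutionCondition φ)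
    (hf : MemLp f 2 mu2) :
    ∫⁻ z, ‖stockwell φ f z‖ₑ ^ 2 ∂mu4 = admConst φ * ∫⁻ x, ‖f x‖ₑ ^ 2 ∂mu2 := by
  have h1 := hφ.memL1
  have h2 := hφ.memL2
  have hC := hφ.const_lt_top.ne
  have hψ1 : MemLp (fun x => projM (star (φ x))) 1 mu2 := projM.comp_memLp' (memLp_star h1)
  have hψ2 : MemLp (fun x => projM (star (φ x))) 2 mu2 := projM.comp_memLp' (memLp_star h2)
  have hP : MemLp (fun x => projP (f x)) 2 mu2 := projP.comp_memLp' hf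
  have hM : MemLp (fun x => projM (f x)) 2 mu2 := projM.comp_memLp' hf
  have mP := (stronglyMeasurable_cStock hψ1.1 hP.1).measurable.enorm.pow_const 2
  have mM := (stronglyMeasurable_cStock hψ1.1 hM.1).measurable.enorm.pow_const 2
  rw [admConst_eq_cAdm h1 h2 hconv] at hC ⊢
  simp only [enorm_sq_eq_projP_projM (stockwell _ _ _), projM_stockwell h1 h2 hconv hf,
    projP_stockwell h1 h2 hconv hf]
  rw [lintegral_const_mul' _ _ (by simp), lintegral_add_right _ mM,
    lintegral_comp_reflect mP, lintegral_enorm_sq_eq_projP_projM hf]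
  rw [lintegral_cStock_sq hψ1 hψ2 hC hP, lintegral_cStock_sq hψ1 hψ2 hC hM, ← mul_add,
    mul_left_comm]

theorem enorm_stockwell_le (h2 : MemLp φ 2 mu2) (hf : MemLp f 2 mu2)
    (z : (ℝ × ℝ) × (ℝ × ℝ)) :
    ‖stockwell φ f z‖ₑ ≤ eLpNorm f 2 mu2 * eLpNorm φ 2 mu2 := by
  refine le_trans ?_ (sqrt_detA_mul_lintegral_le hf.1 h2.1 z.1 z.2)
  rw [stockwell, enorm_smul]
  gcongr
  refine (enorm_integral_le_lintegral_enorm _).trans_eq (lintegral_congr fun x => ?_)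
  simp only [← ofReal_norm, norm_mul, norm_expI, norm_expJ, norm_star, one_mul, mul_one]
  rw [ENNReal.ofReal_mul (norm_nonneg _)]

end QuaternionStockwell

/-! ### From concentration to the measure bound -/

section Concentration

theorem ofReal_one_sub_mul_lintegral_le {F : (ℝ × ℝ) × (ℝ × ℝ) → ℍ[ℝ]}
    {S : Set ((ℝ × ℝ) × (ℝ × ℝ))} (hS : MeasurableSet S) {α : ℝ} (hα0 : 0 ≤ α)
    (hconc : IsConcentrated α F S) (hfin : ∫⁻ z, ‖F z‖ₑ ^ 2 ∂mu4 ≠ ∞) :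
    ENNReal.ofReal (1 - α ^ 2) * ∫⁻ z, ‖F z‖ₑ ^ 2 ∂mu4 ≤ ∫⁻ z in S, ‖F z‖ₑ ^ 2 ∂mu4 := by
  have hc : ∫⁻ z in Sᶜ, ‖F z‖ₑ ^ 2 ∂mu4 ≤
      ENNReal.ofReal (α ^ 2) * ∫⁻ z, ‖F z‖ₑ ^ 2 ∂mu4 := by
    have := pow_le_pow_left' hconc 2
    rwa [mul_pow, eLpNorm_two_sq, eLpNorm_two_sq, ← ENNReal.ofReal_pow hα0] at this
  -- Finite energy lets multiplication distribute over truncated subtraction.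
  rw [ENNReal.ofReal_sub _ (sq_nonneg α), ENNReal.ofReal_one,
    ENNReal.sub_mul fun _ _ => hfin, one_mul, tsub_le_iff_right]
  calc _ = _ := (lintegral_add_compl _ hS).symm
    _ ≤ _ := add_le_add_right hc _

theorem rpow_div_sub_two_le {t p : ℝ} (ht0 : 0 ≤ t) (ht1 : t ≤ 1) (hp : 2 < p) :
    t ^ (p / (p - 2)) ≤ t := by
  have h2 : 0 < p - 2 := sub_pos.2 hp
  have h1 : 1 ≤ p / (p - 2) := by rw [le_div_iff₀ h2]; linarith
  exact Real.rpow_le_self_of_le_one ht0 ht1 h1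

end Concentration

end QStockwell

theorem mainTheorem6 (φ f : ℝ × ℝ → ℍ[ℝ])
    (hφ : QStockwell.IsAdmissibleWindow φ)
    (hconv : QStockwell.ConvolutionCondition φ)
    (hf : MemLp f 2 QStockwell.mu2) (hf0 : ¬ (f =ᵐ[QStockwell.mu2] 0))
    (S : Set ((ℝ × ℝ) × (ℝ × ℝ))) (hS : MeasurableSet S)
    (α : ℝ) (hα0 : 0 ≤ α) (hα1 : α ≤ 1)
    (hconc : QStockwell.IsConcentrated α (QStockwell.stockwell φ f) S)
    (p : ℝ) (hp : 2 < p) :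
    QStockwell.admConst φ * ENNReal.ofReal ((1 - α ^ 2) ^ (p / (p - 2)))
        / eLpNorm φ 2 QStockwell.mu2 ^ 2 ≤ QStockwell.mu4 S := by
  have hPl := QStockwell.lintegral_stockwell_sq hφ hconv hf
  rw [← QStockwell.eLpNorm_two_sq f] at hPl
  have hf2 : eLpNorm f 2 QStockwell.mu2 ^ 2 ≠ ∞ := ENNReal.pow_ne_top hf.2.ne
  have hf2' : eLpNorm f 2 QStockwell.mu2 ^ 2 ≠ 0 :=
    pow_ne_zero 2 fun h => hf0 ((eLpNorm_eq_zero_iff hf.1 two_ne_zero).1 h)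
  have hφ2 : eLpNorm φ 2 QStockwell.mu2 ^ 2 ≠ ∞ := ENNReal.pow_ne_top hφ.memL2.2.ne
  have hφ2' : eLpNorm φ 2 QStockwell.mu2 ^ 2 ≠ 0 :=
    pow_ne_zero 2 fun h => hφ.ne_zero ((eLpNorm_eq_zero_iff hφ.memL2.1 two_ne_zero).1 h)
  have hlow := QStockwell.ofReal_one_sub_mul_lintegral_le hS hα0 hconc
    (by rw [hPl]; exact ENNReal.mul_ne_top hφ.const_lt_top.ne hf2)
  have hup : ∫⁻ z in S, ‖QStockwell.stockwell φ f z‖ₑ ^ 2 ∂QStockwell.mu4 ≤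
      QStockwell.mu4 S * eLpNorm φ 2 QStockwell.mu2 ^ 2 * eLpNorm f 2 QStockwell.mu2 ^ 2 := by
    calc _ ≤ ∫⁻ _ in S, (eLpNorm f 2 QStockwell.mu2 * eLpNorm φ 2 QStockwell.mu2) ^ 2
          ∂QStockwell.mu4 :=
          lintegral_mono fun z => pow_le_pow_left' (QStockwell.enorm_stockwell_le hφ.memL2 hf z) 2
      _ = _ := by rw [setLIntegral_const]; ring
  have h := hlow.trans hup
  -- Plancherel puts ‖f‖² on both sides; it is cancelled as nonzero and finite.
  rw [hPl, ← mul_assoc, ENNReal.mul_le_mul_iff_left hf2' hf2] at h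
  rw [ENNReal.div_le_iff hφ2' hφ2]
  refine le_trans ?_ h
  rw [mul_comm]
  gcongr
  -- The exponent p enters only here, weakening 1-α² to its power.
  exact QStockwell.rpow_div_sub_two_le (by nlinarith) (by nlinarith) hp
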